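/- \textbf{Conventions.} A locale is given by its frame of opens; a map of locales $f:X\to Y$ is given by a frame homomorphism $f^*:Y\to X$. It is \emph{open} if $f^*$ has a left adjoint $f_!$ with $f_!(x\wedge f^*(y))=f_!(x)\wedge y$, and \emph{surjective} if $f^*$ is injective. Greatest elements are written $1$. For sup-lattices $U,V$ with a right, respectively left, action of $B$, $U\otimes_B V$ is the sup-lattice tensor product balanced over $B$. \textbf{Groupoid quantales.} Let $A$ be a locale and $Q$ a frame which is an involutive quantale (an associative multiplication preserving joins in each variable, with a join-preserving involution, $(xy)^*=y^*x^*$), with commuting unital left and right $(A,\wedge)$-module structures $a|q$, $q|a$ such that $(a|x)y=a|(xy)$, $(x|a)y=x(a|y)$, $(xy)|a=x(y|a)$, $(a|x|b)^*=b|x^*|a$, $(a|q)\wedge m=a|(q\wedge m)$, $m\wedge(q|a)=(q\wedge m)|a$. Then $Q$ is a \emph{groupoid quantale} with base $A$ if it is equipped with a sup-lattice homomorphism $\varsigma_Q:Q\to A$ and a frame homomorphism $\upsilon:Q\to A$ such that $\varsigma_Q(1)=1$, $\varsigma_Q(x)|y\le xx^*y$, $\varsigma_Q(x)|x=x$, $\varsigma_Q(a|x)=a\wedge\varsigma_Q(x)$,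 $\upsilon(a|1)=a=\upsilon(1|a)$, the right adjoint of the multiplication $Q\otimes_AQ\to Q$ preserves joins, $\bigvee_{xy\le a}\upsilon(x)|y=a$, and $\upsilon(a)|1=\bigvee_{xx^*\le a}x$. Its open localic groupoid $G=\mathcal G(Q)$ has $G_0=A$, $G_1=Q$, $d^*(a)=a|1$, $r^*(a)=1|a$, $u^*=\upsilon$, $i^*(q)=q^*$, $m^*(a)=\bigvee_{xy\le a}x\otimes y$, where $G_2=G_1\times_{G_0}G_1$ is the pullback of $r$ and $d$. \textbf{Principal $Q$-locales.} A \emph{$Q$-locale} is a locale $X$ with an associative action $Q\times X\to X$, $(q,x)\mapsto q\cdot x$, preserving joins in each variable, a unital $(A,\wedge)$-module structure $a|x$ with $(a|q)\cdot x=a|(q\cdot x)$, $(q|a)\cdot x=q\cdot(a|x)$, $a|(x\wedge y)=(a|x)\wedge y$, an inner product $\langle-,-\rangle:X\times X\to Q$ with $\langle q\cdot x,y\rangle=q\langle x,y\rangle$, $a|\langle x,1\rangle=\langle a|x,1\rangle$, $\langle\bigvee_\alpha x_\alpha,y\rangle=\bigvee_\alpha\langle x_\alpha,y\rangle$, $\langle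 x,y\rangle=\langle y,x\rangle^*$, and a monotone map $\varsigma_X:X\to A$ with $\varsigma_X(1)=1$, $\varsigma_X(x)|1\le\langle x,x\rangle\cdot1$, $\varsigma_X(x)|x=x$, $\varsigma_X(q\cdot x)\le\varsigma_Q(q)$, such that $x\mapsto\bigvee_{q\cdot y\le x}q\otimes y$, $X\to Q\otimes_AX$, preserves joins and $\bigvee_{q\cdot y\le x}\upsilon(q)|y=x$ for all $x$. It is \emph{principal over a locale $M$} if it is equipped with an open map $\pi:X\to M$ with direct image $\tilde\varsigma=\pi_!$ such that $\tilde\varsigma(1)=1$, $\tilde\varsigma(q\cdot x)=\tilde\varsigma(\varsigma_Q(q^*)|x)$ for all $q\in Q$, $x\in X$, and $x\otimes y\mapsto\bigvee_{q\cdot z\le x}q\otimes(z\wedge y)$ defines a frame isomorphism $X\otimes_MX\to Q\otimes_AX$. \textbf{Statement.} Let $Q$ be a groupoid quantale with base $A$, let $G=\mathcal G(Q)$, and let $X$ be a principal $Q$-locale over $M$. Then $X$ is a fully open principal $G$-bundle over $M$, with anchor map $p:X\to G_0$ given by $p^*(a)=a|1$, action $\mathfrak a:G_1\times_{G_0}X\to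 X$ (on the pullback of $r$ and $p$) given by $\mathfrak a^*(x)=\bigvee_{q\cdot y\le x}q\otimes y$, and projection $\pi$. That is: $\mathfrak a$ is a well-defined map of locales with $p\circ\mathfrak a=d\circ\pi_1$ which is associative and unitary, so that $(X,\mathfrak a,p)$ is a $G$-locale; $p$ is an open surjection; $\pi\circ\mathfrak a=\pi\circ\pi_2$; $\pi$ is an open surjection; and the pairing map $\langle\mathfrak a,\pi_2\rangle:G_1\times_{G_0}X\to X\times_MX$ is an isomorphism of locales. -/

import Mathlib

/-! ## Locales

A locale is given by its frame of opens. A map of locales `X → Y` is given by its inverse image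
homomorphism, a frame homomorphism from the frame of `Y` to the frame of `X`. -/

universe u v w z

/-- Maps of locales `X → Y`. -/
@[ext]
structure LocMap (X : Type u) (Y : Type v) [Order.Frame X] [Order.Frame Y] where
  /-- the inverse image homomorphism `f^*` -/
  inv : FrameHom Y X

namespace LocMap

variable {X : Type u} {Y : Type v} {Z : Type w} [Order.Frame X] [Order.Frame Y] [Order.Frame Z]

/-- The identity map of a locale. -/
def id (X : Type u) [Order.Frame X] : LocMap X X := ⟨FrameHom.id X⟩

/-- Composition `g ∘ f` of maps of locales. -/
def comp (g : LocMap Y Z) (f : LocMap X Y) : LocMap X Z := ⟨f.inv.comp g.inv⟩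

/-- `h` is a direct image `f_!` of `f` exhibiting `f` as open: it is left adjoint to `f^*` and
satisfies the Frobenius condition. -/
structure IsOpenDirectImage (f : LocMap X Y) (h : X → Y) : Prop where
  gc : GaloisConnection h f.inv
  frobenius : ∀ (a : X) (b : Y), h (a ⊓ f.inv b) = h a ⊓ b

/-- Open maps of locales. -/
def IsOpen (f : LocMap X Y) : Prop := ∃ h : X → Y, f.IsOpenDirectImage h

/-- Surjections of locales: the inverse image homomorphism is injective. -/
def IsSurjection (f : LocMap X Y) : Prop := Function.Injective f.inv

/-- Isomorphisms of locales. -/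
def IsIso (f : LocMap X Y) : Prop := ∃ g : LocMap Y X, g.comp f = id X ∧ f.comp g = id Y

theorem comp_id (f : LocMap X Y) : f.comp (id X) = f := rfl

theorem section_comp {f : LocMap X Y} {s : LocMap Y X} (h : f.comp s = id Y) (k : LocMap Z Y) :
    f.comp (s.comp k) = k.comp (id Z) := congrArg (fun t => t.comp k) h

end LocMap

/-! ## Tensor products of sup-lattices -/

section Tensor

variable {A : Type u} {M : Type v} {N : Type w} [CompleteLattice M] [CompleteLattice N]

/-- `U ⊆ M × N` is a bi-ideal over `A`, for a right action `ρ` of `A` on `M` and a left action `l`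
of `A` on `N`: it is closed under joins and downwards in each variable, and it is balanced. -/
structure IsBiideal (ρ : M → A → M) (l : A → N → N) (U : Set (M × N)) : Prop where
  left : ∀ (S : Set M) (n : N), (sSup S, n) ∈ U ↔ ∀ s ∈ S, (s, n) ∈ U
  right : ∀ (m : M) (S : Set N), (m, sSup S) ∈ U ↔ ∀ s ∈ S, (m, s) ∈ U
  balanced : ∀ (m : M) (a : A) (n : N), (ρ m a, n) ∈ U ↔ (m, l a n) ∈ U

/-- The tensor product `M ⊗_A N` in the category of sup-lattices, realized as the complete lattice
of bi-ideals ordered by inclusion. -/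
@[ext]
structure SupTensor (ρ : M → A → M) (l : A → N → N) where
  carrier : Set (M × N)
  isBiideal : IsBiideal ρ l carrier

namespace SupTensor

variable {ρ : M → A → M} {l : A → N → N}

theorem _root_.IsBiideal.mono {U : Set (M × N)} (h : IsBiideal ρ l U) {m m' : M} {n n' : N}
    (hm : m ≤ m') (hn : n ≤ n') (hU : (m', n') ∈ U) : (m, n) ∈ U := by
  have h1 : (m, n') ∈ U := by
    have := (h.left {m, m'} n').1 (by rw [sSup_pair, sup_eq_right.2 hm]; exact hU)
    exact this m (by simp)
  have := (h.right m {n, n'}).1 (by rw [sSup_pair, sup_eq_right.2 hn]; exact h1)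
  exact this n (by simp)

instance : PartialOrder (SupTensor ρ l) :=
  PartialOrder.lift SupTensor.carrier (fun _ _ h => SupTensor.ext h)

instance : InfSet (SupTensor ρ l) where
  sInf T := ⟨{t | ∀ U ∈ T, t ∈ U.carrier},
    { left := fun S n =>
        ⟨fun h s hs U hU => (U.isBiideal.left S n).1 (h U hU) s hs,
          fun h U hU => (U.isBiideal.left S n).2 fun s hs => h s hs U hU⟩
      right := fun m S =>
        ⟨fun h s hs U hU => (U.isBiideal.right m S).1 (h U hU) s hs,
          fun h U hU => (U.isBiideal.right m S).2 fun s hs => h s hs U hU⟩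
      balanced := fun m a n =>
        ⟨fun h U hU => (U.isBiideal.balanced m a n).1 (h U hU),
          fun h U hU => (U.isBiideal.balanced m a n).2 (h U hU)⟩ }⟩

instance : CompleteLattice (SupTensor ρ l) :=
  completeLatticeOfInf _ fun _ =>
    ⟨fun _ hU _ ht => ht _ hU, fun _ hV _ ht _ hU => hV hU ht⟩

/-- The pure tensor `m ⊗ n`: the least bi-ideal containing `(m, n)`. -/
def tmul (ρ : M → A → M) (l : A → N → N) (m : M) (n : N) : SupTensor ρ l :=
  sInf {U | (m, n) ∈ U.carrier}

theorem tmul_le_iff {m : M} {n : N} {U : SupTensor ρ l} :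
    tmul ρ l m n ≤ U ↔ (m, n) ∈ U.carrier := by
  refine ⟨fun h => h ?_, fun h => sInf_le h⟩
  intro V hV
  exact hV

theorem mem_tmul (m : M) (n : N) : (m, n) ∈ (tmul ρ l m n).carrier := tmul_le_iff.1 le_rfl

theorem mem_inf {U V : SupTensor ρ l} {t : M × N} :
    t ∈ (U ⊓ V).carrier ↔ t ∈ U.carrier ∧ t ∈ V.carrier := by
  obtain ⟨m, n⟩ := t
  rw [← tmul_le_iff, ← tmul_le_iff, ← tmul_le_iff, le_inf_iff]

/-- The universal property of `M ⊗_A N`: a map `M × N → P` that preserves joins in each variable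
and is balanced factors uniquely through `⊗` by a sup-lattice homomorphism. -/
theorem existsUnique_lift {P : Type z} [CompleteLattice P] (f : M → N → P)
    (hl : ∀ (S : Set M) (n : N), f (sSup S) n = ⨆ s ∈ S, f s n)
    (hr : ∀ (m : M) (S : Set N), f m (sSup S) = ⨆ s ∈ S, f m s)
    (hb : ∀ (m : M) (a : A) (n : N), f (ρ m a) n = f m (l a n)) :
    ∃! g : sSupHom (SupTensor ρ l) P, ∀ m n, g (tmul ρ l m n) = f m n := by
  let R : P → SupTensor ρ l := fun p => ⟨{t | f t.1 t.2 ≤ p},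
    { left := fun S n => by simp [hl]
      right := fun m S => by simp [hr]
      balanced := fun m a n => by simp [hb] }⟩
  let G : SupTensor ρ l → P := fun U => ⨆ t ∈ U.carrier, f t.1 t.2
  have gc : GaloisConnection G R := fun U p =>
    ⟨fun h t ht => le_trans (le_iSup₂ (f := fun t (_ : t ∈ U.carrier) => f t.1 t.2) t ht) h,
      fun h => iSup₂_le fun t ht => h ht⟩
  refine ⟨⟨G, fun S => by rw [gc.l_sSup, sSup_image]⟩, ?_, ?_⟩
  · intro m n
    refine le_antisymm ((gc _ _).2 (tmul_le_iff.2 (le_refl (f m n)))) ?_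
    exact le_iSup₂ (f := fun t (_ : t ∈ (tmul ρ l m n).carrier) => f t.1 t.2) (m, n)
      (mem_tmul m n)
  · intro g hg
    ext U
    have hU : U = sSup {V | ∃ t ∈ U.carrier, V = tmul ρ l t.1 t.2} := by
      refine le_antisymm (fun t ht => ?_) (sSup_le ?_)
      · exact tmul_le_iff.1 (le_sSup ⟨t, ht, rfl⟩)
      · rintro V ⟨t, ht, rfl⟩
        exact tmul_le_iff.2 ht
    have h1 : g U = sSup (g '' {V | ∃ t ∈ U.carrier, V = tmul ρ l t.1 t.2}) := by
      conv_lhs => rw [hU]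
      exact map_sSup g _
    rw [h1]
    refine le_antisymm (sSup_le ?_) (iSup₂_le fun t ht => ?_)
    · rintro _ ⟨_, ⟨t, ht, rfl⟩, rfl⟩
      rw [hg]
      exact le_iSup₂ (f := fun t (_ : t ∈ U.carrier) => f t.1 t.2) t ht
    · rw [← hg]
      exact le_sSup ⟨_, ⟨t, ht, rfl⟩, rfl⟩

/-- The map `z ↦ ⋁ {m ⊗ n | μ m n ≤ z}`. For a bilinear balanced `μ` this is the right adjoint of
the sup-lattice homomorphism `M ⊗_A N → P` that `μ` induces. -/
def rightAdjoint {P : Type z} [LE P] (ρ : M → A → M) (l : A → N → N) (μ : M → N → P) (p : P) :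
    SupTensor ρ l :=
  ⨆ (m : M) (n : N) (_ : μ m n ≤ p), tmul ρ l m n

theorem rightAdjoint_le_iff {P : Type z} [LE P] {μ : M → N → P} {p : P} {U : SupTensor ρ l} :
    rightAdjoint ρ l μ p ≤ U ↔ ∀ m n, μ m n ≤ p → (m, n) ∈ U.carrier := by
  simp only [rightAdjoint, iSup_le_iff, tmul_le_iff]

theorem mem_rightAdjoint {P : Type z} [CompleteLattice P] {μ : M → N → P}
    (hl : ∀ (S : Set M) (n : N), μ (sSup S) n = ⨆ s ∈ S, μ s n)
    (hr : ∀ (m : M) (S : Set N), μ m (sSup S) = ⨆ s ∈ S, μ m s)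
    (hb : ∀ (m : M) (a : A) (n : N), μ (ρ m a) n = μ m (l a n)) {p : P} {m : M} {n : N} :
    (m, n) ∈ (rightAdjoint ρ l μ p).carrier ↔ μ m n ≤ p := by
  constructor
  · have : rightAdjoint ρ l μ p ≤ ⟨{t | μ t.1 t.2 ≤ p},
      { left := fun S n => by simp [hl]
        right := fun m S => by simp [hr]
        balanced := fun m a n => by simp [hb] }⟩ := rightAdjoint_le_iff.2 fun m n h => h
    exact fun h => this h
  · exact fun h => rightAdjoint_le_iff.1 le_rfl m n h

end SupTensor

end Tensor

/-! ## Pullbacks of locales -/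

section Pullback

variable {X : Type u} {Y : Type v} {B : Type w} [Order.Frame X] [Order.Frame Y] [Order.Frame B]

/-- The pullback `X ×_B Y` of two maps of locales `f : X → B` and `g : Y → B`. Its frame is the
tensor product of the frames of `X` and `Y` over that of `B`. -/
def LocPullback (f : LocMap X B) (g : LocMap Y B) : Type (max u v) :=
  SupTensor (fun (x : X) (b : B) => x ⊓ f.inv b) (fun (b : B) (y : Y) => g.inv b ⊓ y)

namespace LocPullback

variable {f : LocMap X B} {g : LocMap Y B}

instance : CompleteLattice (LocPullback f g) :=
  inferInstanceAs (CompleteLattice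
    (SupTensor (fun (x : X) (b : B) => x ⊓ f.inv b) (fun (b : B) (y : Y) => g.inv b ⊓ y)))

/-- The open `x ⊗ y` of `X ×_B Y`. -/
def tmul (f : LocMap X B) (g : LocMap Y B) (x : X) (y : Y) : LocPullback f g :=
  SupTensor.tmul _ _ x y

theorem tmul_le_iff {x : X} {y : Y} {U : LocPullback f g} :
    tmul f g x y ≤ U ↔ (x, y) ∈ U.carrier := SupTensor.tmul_le_iff

theorem mem_tmul (x : X) (y : Y) : (x, y) ∈ (tmul f g x y).carrier := SupTensor.mem_tmul x y

theorem mem_inf {U V : LocPullback f g} {t : X × Y} :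
    t ∈ (U ⊓ V).carrier ↔ t ∈ U.carrier ∧ t ∈ V.carrier := SupTensor.mem_inf

theorem le_def {U V : LocPullback f g} : U ≤ V ↔ U.carrier ⊆ V.carrier := Iff.rfl

/-- The implication `V ⇒ T` in the frame of `X ×_B Y`, for an arbitrary set `V` of pairs. -/
def residual (V : Set (X × Y)) (T : LocPullback f g) : LocPullback f g :=
  ⟨{t | ∀ s ∈ V, (t.1 ⊓ s.1, t.2 ⊓ s.2) ∈ T.carrier},
    { left := fun S n => by
        constructor
        · intro h s hs t ht
          exact T.isBiideal.mono (inf_le_inf_right _ (le_sSup hs)) le_rfl (h t ht)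
        · intro h t ht
          have : sSup S ⊓ t.1 = sSup ((fun s => s ⊓ t.1) '' S) := by
            rw [sSup_inf_eq, sSup_image]
          change (sSup S ⊓ t.1, n ⊓ t.2) ∈ T.carrier
          rw [this, T.isBiideal.left]
          rintro _ ⟨s, hs, rfl⟩
          exact h s hs t ht
      right := fun m S => by
        constructor
        · intro h s hs t ht
          exact T.isBiideal.mono le_rfl (inf_le_inf_right _ (le_sSup hs)) (h t ht)
        · intro h t ht
          have : sSup S ⊓ t.2 = sSup ((fun s => s ⊓ t.2) '' S) := by
            rw [sSup_inf_eq, sSup_image]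
          change (m ⊓ t.1, sSup S ⊓ t.2) ∈ T.carrier
          rw [this, T.isBiideal.right]
          rintro _ ⟨s, hs, rfl⟩
          exact h s hs t ht
      balanced := fun m a n => by
        have key : ∀ t : X × Y, (m ⊓ f.inv a ⊓ t.1, n ⊓ t.2) ∈ T.carrier ↔
            (m ⊓ t.1, g.inv a ⊓ n ⊓ t.2) ∈ T.carrier := fun t => by
          have := T.isBiideal.balanced (m ⊓ t.1) a (n ⊓ t.2)
          rwa [inf_right_comm, ← inf_assoc] at this
        exact ⟨fun h t ht => (key t).1 (h t ht), fun h t ht => (key t).2 (h t ht)⟩ }⟩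

theorem mem_residual {V : Set (X × Y)} {T : LocPullback f g} {t : X × Y} :
    t ∈ (residual V T).carrier ↔ ∀ s ∈ V, (t.1 ⊓ s.1, t.2 ⊓ s.2) ∈ T.carrier := Iff.rfl

instance : Order.Frame (LocPullback f g) :=
  Order.Frame.ofMinimalAxioms
    { inf_sSup_le_iSup_inf := fun U S => by
        have h : sSup S ≤ residual U.carrier (⨆ V ∈ S, U ⊓ V) := by
          refine sSup_le fun V hV t ht s hs => ?_
          refine le_def.1 (le_iSup₂ (f := fun V (_ : V ∈ S) => U ⊓ V) V hV) ?_
          exact mem_inf.2 ⟨U.isBiideal.mono inf_le_right inf_le_right hs,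
            V.isBiideal.mono inf_le_left inf_le_left ht⟩
        intro t ht
        have := h (mem_inf.1 ht).2 t (mem_inf.1 ht).1
        rwa [inf_idem, inf_idem] at this }

theorem tmul_inf_tmul (x x' : X) (y y' : Y) :
    tmul f g x y ⊓ tmul f g x' y' = tmul f g (x ⊓ x') (y ⊓ y') := by
  apply le_antisymm
  · have h1 : tmul f g x y ≤ residual {(x', y')} (tmul f g (x ⊓ x') (y ⊓ y')) :=
      tmul_le_iff.2 (mem_residual.2 fun s hs => by
        rw [Set.mem_singleton_iff.1 hs]; exact mem_tmul _ _)
    have h2 : tmul f g x' y' ≤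
        residual (tmul f g x y).carrier (tmul f g (x ⊓ x') (y ⊓ y')) :=
      tmul_le_iff.2 (mem_residual.2 fun s hs => by
        have := mem_residual.1 (h1 hs) (x', y') rfl
        rwa [inf_comm s.1, inf_comm s.2] at this)
    intro t ht
    have := mem_residual.1 (h2 (mem_inf.1 ht).2) t (mem_inf.1 ht).1
    rwa [inf_idem, inf_idem] at this
  · exact tmul_le_iff.2 (mem_inf.2
      ⟨(tmul f g x y).isBiideal.mono inf_le_left inf_le_left (mem_tmul _ _),
        (tmul f g x' y').isBiideal.mono inf_le_right inf_le_right (mem_tmul _ _)⟩)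

theorem tmul_top_top : tmul f g ⊤ ⊤ = ⊤ :=
  top_le_iff.1 fun _ _ => (tmul f g ⊤ ⊤).isBiideal.mono le_top le_top (mem_tmul _ _)

/-- The first projection `π₁ : X ×_B Y → X`, with `π₁^* x = x ⊗ 1`. -/
def fst (f : LocMap X B) (g : LocMap Y B) : LocMap (LocPullback f g) X :=
  ⟨{ toFun := fun x => tmul f g x ⊤
     map_inf' := fun x x' => by rw [tmul_inf_tmul, inf_idem]
     map_top' := tmul_top_top
     map_sSup' := fun S => eq_of_forall_ge_iff fun U => by
      rw [tmul_le_iff, U.isBiideal.left, sSup_le_iff, Set.forall_mem_image]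
      simp only [tmul_le_iff] }⟩

/-- The second projection `π₂ : X ×_B Y → Y`, with `π₂^* y = 1 ⊗ y`. -/
def snd (f : LocMap X B) (g : LocMap Y B) : LocMap (LocPullback f g) Y :=
  ⟨{ toFun := fun y => tmul f g ⊤ y
     map_inf' := fun y y' => by rw [tmul_inf_tmul, inf_idem]
     map_top' := tmul_top_top
     map_sSup' := fun S => eq_of_forall_ge_iff fun U => by
      rw [tmul_le_iff, U.isBiideal.right, sSup_le_iff, Set.forall_mem_image]
      simp only [tmul_le_iff] }⟩

theorem fst_inv (x : X) : (fst f g).inv x = tmul f g x ⊤ := rfl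

theorem snd_inv (y : Y) : (snd f g).inv y = tmul f g ⊤ y := rfl

theorem fst_inf_snd (x : X) (y : Y) : (fst f g).inv x ⊓ (snd f g).inv y = tmul f g x y := by
  rw [fst_inv, snd_inv, tmul_inf_tmul, inf_top_eq, top_inf_eq]

/-- The pullback square commutes. -/
theorem condition (f : LocMap X B) (g : LocMap Y B) :
    f.comp (fst f g) = g.comp (snd f g) := by
  apply LocMap.ext
  ext b
  change tmul f g (f.inv b) ⊤ = tmul f g ⊤ (g.inv b)
  refine eq_of_forall_ge_iff fun U => ?_
  rw [tmul_le_iff, tmul_le_iff]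
  have := U.isBiideal.balanced ⊤ b ⊤
  rwa [top_inf_eq, inf_top_eq] at this

theorem eq_sSup_tmul (U : LocPullback f g) : U = ⨆ t ∈ U.carrier, tmul f g t.1 t.2 := by
  refine le_antisymm (fun t ht => ?_) (iSup₂_le fun t ht => tmul_le_iff.2 ht)
  exact tmul_le_iff.1 (le_iSup₂ (f := fun t (_ : t ∈ U.carrier) => tmul f g t.1 t.2) t ht)

section Lift

variable {Z : Type z} [Order.Frame Z] {h : LocMap Z X} {k : LocMap Z Y}

/-- The right adjoint of the inverse image of the pairing of `h` and `k`. -/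
def liftAdjoint (e : f.comp h = g.comp k) (c : Z) : LocPullback f g :=
  ⟨{t | h.inv t.1 ⊓ k.inv t.2 ≤ c},
    { left := fun S n => by simp [map_sSup, sSup_inf_eq]
      right := fun m S => by simp [map_sSup, inf_sSup_eq]
      balanced := fun m b n => by
        have : h.inv (f.inv b) = k.inv (g.inv b) := congrArg (fun s => s.inv b) e
        change h.inv (m ⊓ f.inv b) ⊓ k.inv n ≤ c ↔ h.inv m ⊓ k.inv (g.inv b ⊓ n) ≤ c
        rw [map_inf, map_inf, this, inf_assoc] }⟩

theorem lift_gc (e : f.comp h = g.comp k) :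
    GaloisConnection (fun U : LocPullback f g => ⨆ t ∈ U.carrier, h.inv t.1 ⊓ k.inv t.2)
      (liftAdjoint e) := fun U _ =>
  ⟨fun hc t ht => le_trans
      (le_iSup₂ (f := fun t (_ : t ∈ U.carrier) => h.inv t.1 ⊓ k.inv t.2) t ht) hc,
    fun hc => iSup₂_le fun _ ht => hc ht⟩

/-- The map `⟨h, k⟩ : Z → X ×_B Y` induced by `h : Z → X` and `k : Z → Y` with `f h = g k`. Its
inverse image is `x ⊗ y ↦ h^* x ∧ k^* y`. -/
def lift (h : LocMap Z X) (k : LocMap Z Y) (e : f.comp h = g.comp k) :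
    LocMap Z (LocPullback f g) :=
  ⟨{ toFun := fun U => ⨆ t ∈ U.carrier, h.inv t.1 ⊓ k.inv t.2
     map_inf' := fun U V => by
      refine le_antisymm
        (le_inf ((lift_gc e).monotone_l inf_le_left) ((lift_gc e).monotone_l inf_le_right)) ?_
      simp only [iSup_inf_eq, inf_iSup_eq, iSup_le_iff]
      intro t ht s hs
      refine le_trans ?_ (le_iSup₂ (f := fun t (_ : t ∈ (U ⊓ V).carrier) =>
        h.inv t.1 ⊓ k.inv t.2) (t ⊓ s) (mem_inf.2
          ⟨U.isBiideal.mono inf_le_right inf_le_right hs,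
            V.isBiideal.mono inf_le_left inf_le_left ht⟩))
      change _ ≤ h.inv (t.1 ⊓ s.1) ⊓ k.inv (t.2 ⊓ s.2)
      rw [map_inf, map_inf, inf_inf_inf_comm, inf_comm]
      exact le_of_eq (by ac_rfl)
     map_top' := top_le_iff.1 (le_trans (by simp)
      (le_iSup₂ (f := fun t (_ : t ∈ (⊤ : LocPullback f g).carrier) => h.inv t.1 ⊓ k.inv t.2)
        ((⊤ : X), (⊤ : Y)) (tmul_le_iff.1 le_top)))
     map_sSup' := fun S => by rw [(lift_gc e).l_sSup, sSup_image] }⟩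

theorem lift_inv (e : f.comp h = g.comp k) (U : LocPullback f g) :
    (lift h k e).inv U = ⨆ t ∈ U.carrier, h.inv t.1 ⊓ k.inv t.2 := rfl

theorem lift_le_iff (e : f.comp h = g.comp k) {U : LocPullback f g} {c : Z} :
    (lift h k e).inv U ≤ c ↔ ∀ x y, (x, y) ∈ U.carrier → h.inv x ⊓ k.inv y ≤ c := by
  rw [lift_inv]
  simp only [iSup_le_iff, Prod.forall]

theorem lift_tmul (e : f.comp h = g.comp k) (x : X) (y : Y) :
    (lift h k e).inv (tmul f g x y) = h.inv x ⊓ k.inv y := by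
  refine le_antisymm (((lift_gc e) _ _).2 (tmul_le_iff.2 (le_refl (h.inv x ⊓ k.inv y)))) ?_
  exact le_iSup₂ (f := fun t (_ : t ∈ (tmul f g x y).carrier) => h.inv t.1 ⊓ k.inv t.2) (x, y)
    (mem_tmul x y)

theorem fst_lift (e : f.comp h = g.comp k) : (fst f g).comp (lift h k e) = h := by
  apply LocMap.ext
  ext x
  change (lift h k e).inv (tmul f g x ⊤) = _
  rw [lift_tmul, map_top, inf_top_eq]

theorem snd_lift (e : f.comp h = g.comp k) : (snd f g).comp (lift h k e) = k := by
  apply LocMap.ext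
  ext x
  change (lift h k e).inv (tmul f g ⊤ x) = _
  rw [lift_tmul, map_top, top_inf_eq]

/-- A map into a pullback is determined by its two components. -/
theorem hom_ext {s t : LocMap Z (LocPullback f g)}
    (h₁ : (fst f g).comp s = (fst f g).comp t) (h₂ : (snd f g).comp s = (snd f g).comp t) :
    s = t := by
  have key : ∀ x y, s.inv (tmul f g x y) = t.inv (tmul f g x y) := fun x y => by
    have e₁ : s.inv ((fst f g).inv x) = t.inv ((fst f g).inv x) := congrArg (fun m => m.inv x) h₁
    have e₂ : s.inv ((snd f g).inv y) = t.inv ((snd f g).inv y) := congrArg (fun m => m.inv y) h₂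
    rw [← fst_inf_snd, map_inf, map_inf, e₁, e₂]
  apply LocMap.ext
  ext U
  rw [eq_sSup_tmul U]
  simp only [map_iSup, key]

theorem condition_comp {f : LocMap X B} {g : LocMap Y B} (k : LocMap Z (LocPullback f g)) :
    f.comp ((fst f g).comp k) = g.comp ((snd f g).comp k) :=
  congrArg (fun t => t.comp k) (condition f g)

theorem condition_of {q : LocMap Z B} {a : LocMap Z Y} (e : g.comp a = q) :
    f.comp (fst f q) = g.comp (a.comp (snd f q)) := by
  subst e
  exact condition f (g.comp a)

theorem comp_lift_condition {W : Type*} {C : Type*} [Order.Frame W] [Order.Frame C]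
    {m : LocMap (LocPullback f g) W} {s : LocMap W C} {t : LocMap Y C} {c : LocMap Z C}
    {e : f.comp h = g.comp k} (hm : s.comp m = t.comp (snd f g)) (hc : t.comp k = c) :
    s.comp (m.comp (lift h k e)) = c := by
  have h₁ : s.comp (m.comp (lift h k e)) = t.comp ((snd f g).comp (lift h k e)) :=
    congrArg (fun u => u.comp (lift h k e)) hm
  rw [h₁, snd_lift, hc]

end Lift

end LocPullback

end Pullback

/-! ## Open localic groupoids -/

/-- A localic groupoid: an internal groupoid in the category of locales. A composable pair `(g, h)`
satisfies `r g = d h`, and then `d (g h) = d g` and `r (g h) = r h`. -/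
structure LocalicGroupoid (G₀ : Type u) (G₁ : Type v) [Order.Frame G₀] [Order.Frame G₁] where
  d : LocMap G₁ G₀
  r : LocMap G₁ G₀
  u : LocMap G₀ G₁
  i : LocMap G₁ G₁
  m : LocMap (LocPullback r d) G₁
  d_u : d.comp u = LocMap.id G₀
  r_u : r.comp u = LocMap.id G₀
  d_m : d.comp m = d.comp (LocPullback.fst r d)
  r_m : r.comp m = r.comp (LocPullback.snd r d)
  d_i : d.comp i = r
  r_i : r.comp i = d
  /-- `g (h k) = (g h) k` on `G₁ ×_{G₀} (G₁ ×_{G₀} G₁)`. -/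
  assoc :
    let π₁ := LocPullback.fst r (d.comp (LocPullback.fst r d))
    let π₂ := LocPullback.snd r (d.comp (LocPullback.fst r d))
    m.comp (LocPullback.lift π₁ (m.comp π₂) (LocPullback.condition_of d_m)) =
      m.comp (LocPullback.lift
        (m.comp (LocPullback.lift π₁ ((LocPullback.fst r d).comp π₂)
          (LocPullback.condition_of rfl)))
        ((LocPullback.snd r d).comp π₂)
        (LocPullback.comp_lift_condition r_m (LocPullback.condition_comp π₂)))
  /-- `u(d g) g = g`. -/
  unit_left : m.comp (LocPullback.lift (u.comp d) (LocMap.id G₁)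
    (LocMap.section_comp r_u d)) = LocMap.id G₁
  /-- `g u(r g) = g`. -/
  unit_right : m.comp (LocPullback.lift (LocMap.id G₁) (u.comp r)
    (LocMap.section_comp d_u r).symm) = LocMap.id G₁
  /-- `g i(g) = u(d g)`. -/
  inv_right : m.comp (LocPullback.lift (LocMap.id G₁) i
    ((LocMap.comp_id r).trans d_i.symm)) = u.comp d
  /-- `i(g) g = u(r g)`. -/
  inv_left : m.comp (LocPullback.lift i (LocMap.id G₁)
    (r_i.trans (LocMap.comp_id d).symm)) = u.comp r

/-- An open localic groupoid. -/
structure OpenGroupoid (G₀ : Type u) (G₁ : Type v) [Order.Frame G₀] [Order.Frame G₁] extends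
    LocalicGroupoid G₀ G₁ where
  d_open : d.IsOpen

section Bundles

variable {G₀ : Type u} {G₁ : Type v} [Order.Frame G₀] [Order.Frame G₁]

/-- A left `G`-locale `(X, act, p)`. -/
structure GLocale (G : OpenGroupoid G₀ G₁) (X : Type w) [Order.Frame X] where
  /-- the anchor map -/
  p : LocMap X G₀
  /-- the action `G₁ ×_{G₀} X → X` -/
  act : LocMap (LocPullback G.r p) X
  p_act : p.comp act = G.d.comp (LocPullback.fst G.r p)
  /-- `g (h x) = (g h) x` on `G₁ ×_{G₀} (G₁ ×_{G₀} X)`. -/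
  assoc :
    let π₁ := LocPullback.fst G.r (G.d.comp (LocPullback.fst G.r p))
    let π₂ := LocPullback.snd G.r (G.d.comp (LocPullback.fst G.r p))
    act.comp (LocPullback.lift π₁ (act.comp π₂) (LocPullback.condition_of p_act)) =
      act.comp (LocPullback.lift
        (G.m.comp (LocPullback.lift π₁ ((LocPullback.fst G.r p).comp π₂)
          (LocPullback.condition_of rfl)))
        ((LocPullback.snd G.r p).comp π₂)
        (LocPullback.comp_lift_condition G.r_m (LocPullback.condition_comp π₂)))
  /-- `u(p x) x = x`. -/
  unit : act.comp (LocPullback.lift (G.u.comp p) (LocMap.id X)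
    (LocMap.section_comp G.r_u p)) = LocMap.id X

/-- A `G`-locale is fully open if its anchor map is an open surjection. -/
def GLocale.IsFullyOpen {G : OpenGroupoid G₀ G₁} {X : Type w} [Order.Frame X]
    (E : GLocale G X) : Prop :=
  E.p.IsOpen ∧ E.p.IsSurjection

/-- A left `G`-bundle over `M`: a `G`-locale `X` with an invariant map `π : X → M`. -/
structure GBundle (G : OpenGroupoid G₀ G₁) (X : Type w) (M : Type z) [Order.Frame X]
    [Order.Frame M] extends GLocale G X where
  π : LocMap X M
  /-- `π (g x) = π x` on `G₁ ×_{G₀} X`. -/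
  invariant : π.comp act = π.comp (LocPullback.snd G.r p)

namespace GBundle

variable {G : OpenGroupoid G₀ G₁} {X : Type w} {M : Type z} [Order.Frame X] [Order.Frame M]

/-- The pairing map `⟨act, π₂⟩ : G₁ ×_{G₀} X → X ×_M X`. -/
def pairing (E : GBundle G X M) : LocMap (LocPullback G.r E.p) (LocPullback E.π E.π) :=
  LocPullback.lift E.act (LocPullback.snd G.r E.p) E.invariant

/-- A `G`-bundle over `M` is principal if `π` is an open surjection and the pairing map is an
isomorphism of locales. -/
structure IsPrincipal (E : GBundle G X M) : Prop where
  π_open : E.π.IsOpen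
  π_surjection : E.π.IsSurjection
  pairing_isIso : E.pairing.IsIso

end GBundle

end Bundles

/-! ## Groupoid quantales -/

/-- `l` is a unital left module structure on the sup-lattice `M` over the locale `A`, whose
multiplication is binary meet. -/
structure IsFrameModule {A : Type u} {M : Type v} [Order.Frame A] [CompleteLattice M]
    (l : A → M → M) : Prop where
  top : ∀ m, l ⊤ m = m
  inf : ∀ a b m, l (a ⊓ b) m = l a (l b m)
  sSup_left : ∀ (S : Set A) (m : M), l (sSup S) m = ⨆ a ∈ S, l a m
  sSup_right : ∀ (a : A) (S : Set M), l a (sSup S) = ⨆ m ∈ S, l a m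

/-- A based quantal frame on the frame `Q` with base locale `A`: an involutive quantale with the
structure of an involutive `A`-`A`-quantale and of a frame, suitably compatible. Here `lact a q` is
the left action of `a` on `q` and `ract q a` is the right action. -/
structure BasedQuantalFrame (A : Type u) (Q : Type v) [Order.Frame A] [Order.Frame Q]
    [Semigroup Q] [IsQuantale Q] [StarMul Q] where
  lact : A → Q → Q
  ract : Q → A → Q
  lact_module : IsFrameModule lact
  ract_module : IsFrameModule (fun a q => ract q a)
  lact_ract : ∀ a q b, ract (lact a q) b = lact a (ract q b)
  lact_mul : ∀ a x y, lact a x * y = lact a (x * y)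
  ract_mul : ∀ a x y, ract x a * y = x * lact a y
  mul_ract : ∀ a x y, ract (x * y) a = x * ract y a
  star_sSup : ∀ S : Set Q, star (sSup S) = ⨆ x ∈ S, star x
  star_lact_ract : ∀ a x b, star (lact a (ract x b)) = lact b (ract (star x) a)
  lact_inf : ∀ a q m, lact a q ⊓ m = lact a (q ⊓ m)
  inf_ract : ∀ a q m, m ⊓ ract q a = ract (q ⊓ m) a

/-- A groupoid quantale: a multiplicative equivariantly supported reflexive quantal frame that
satisfies the unit laws and the inverse laws. The symbol `⊤` is the greatest element, not a
multiplicative unit. -/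
structure GroupoidQuantale (A : Type u) (Q : Type v) [Order.Frame A] [Order.Frame Q]
    [Semigroup Q] [IsQuantale Q] [StarMul Q] extends BasedQuantalFrame A Q where
  /-- the support -/
  supp : sSupHom Q A
  supp_top : supp ⊤ = ⊤
  supp_lact_le : ∀ x y, lact (supp x) y ≤ x * star x * y
  supp_lact_self : ∀ x, lact (supp x) x = x
  /-- equivariance of the support -/
  supp_lact : ∀ a x, supp (lact a x) = a ⊓ supp x
  /-- the reflexive structure -/
  υ : FrameHom Q A
  υ_lact : ∀ a, υ (lact a ⊤) = a
  υ_ract : ∀ a, υ (ract ⊤ a) = a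
  /-- multiplicativity: the right adjoint of `Q ⊗_A Q → Q` preserves joins -/
  multiplicative : ∀ S : Set Q,
    SupTensor.rightAdjoint ract lact (fun x y => x * y) (sSup S) =
      ⨆ a ∈ S, SupTensor.rightAdjoint ract lact (fun x y => x * y) a
  unit_law : ∀ a, ⨆ (x : Q) (y : Q) (_ : x * y ≤ a), lact (υ x) y = a
  inverse_law : ∀ a, lact (υ a) ⊤ = ⨆ (x : Q) (_ : x * star x ≤ a), x

namespace GroupoidQuantale

variable {A : Type u} {Q : Type v} [Order.Frame A] [Order.Frame Q]
  [Semigroup Q] [IsQuantale Q] [StarMul Q] (S : GroupoidQuantale A Q)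

theorem lact_top_inf (a : A) (q : Q) : S.lact a ⊤ ⊓ q = S.lact a q := by
  rw [S.lact_inf, top_inf_eq]

theorem inf_ract_top (a : A) (q : Q) : q ⊓ S.ract ⊤ a = S.ract q a := by
  rw [S.inf_ract, top_inf_eq]

theorem star_lact (a : A) (q : Q) : star (S.lact a q) = S.ract (star q) a := by
  have := S.star_lact_ract a q ⊤
  rwa [S.ract_module.top, S.lact_module.top] at this

theorem star_ract (q : Q) (a : A) : star (S.ract q a) = S.lact a (star q) := by
  have := S.star_lact_ract ⊤ q a
  rwa [S.lact_module.top, S.ract_module.top] at this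

theorem star_mono (S : GroupoidQuantale A Q) {x y : Q} (h : x ≤ y) : star x ≤ star y := by
  have := S.star_sSup {x, y}
  rw [sSup_pair, sup_eq_right.2 h] at this
  rw [this]
  exact le_iSup₂ (f := fun z (_ : z ∈ ({x, y} : Set Q)) => star z) x (by simp)

theorem star_le_iff (S : GroupoidQuantale A Q) {x y : Q} : star x ≤ y ↔ x ≤ star y :=
  ⟨fun h => by simpa using S.star_mono h, fun h => by simpa using S.star_mono h⟩

theorem star_top (S : GroupoidQuantale A Q) : star (⊤ : Q) = ⊤ :=
  top_le_iff.1 (by rw [← S.star_le_iff]; exact le_top)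

/-- The domain map of `𝒢(Q)`: `d^* a` is the action of `a` on the left of `⊤`. -/
def dMap : LocMap Q A :=
  ⟨{ toFun := fun a => S.lact a ⊤
     map_inf' := fun a b => by rw [S.lact_module.inf, S.lact_top_inf]
     map_top' := S.lact_module.top _
     map_sSup' := fun T => by rw [S.lact_module.sSup_left, sSup_image] }⟩

/-- The range map of `𝒢(Q)`: `r^* a` is the action of `a` on the right of `⊤`. -/
def rMap : LocMap Q A :=
  ⟨{ toFun := fun a => S.ract ⊤ a
     map_inf' := fun a b => by
      rw [inf_comm a b, S.ract_module.inf b a, S.inf_ract_top]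
     map_top' := S.ract_module.top _
     map_sSup' := fun T => by rw [S.ract_module.sSup_left, sSup_image] }⟩

/-- The inversion of `𝒢(Q)`: `i^*` is the involution. -/
def iMap : LocMap Q Q :=
  ⟨{ toFun := fun q => star q
     map_inf' := fun a b => eq_of_forall_le_iff fun c => by
      rw [← S.star_le_iff, le_inf_iff, le_inf_iff, ← S.star_le_iff, ← S.star_le_iff]
     map_top' := S.star_top
     map_sSup' := fun T => by rw [S.star_sSup, sSup_image] }⟩

/-- The unit map of `𝒢(Q)`: `u^* = υ`. -/
def uMap : LocMap A Q := ⟨S.υ⟩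

theorem ract_eq : S.ract = fun q a => q ⊓ S.rMap.inv a := by
  funext q a
  exact (S.inf_ract_top a q).symm

theorem lact_eq : S.lact = fun a q => S.dMap.inv a ⊓ q := by
  funext a q
  exact (S.lact_top_inf a q).symm

/-- The map `a ↦ ⋁ {x ⊗ y | x y ≤ a}` to the frame of `G₁ ×_{G₀} G₁`. -/
def mInv (a : Q) : LocPullback S.rMap S.dMap :=
  ⨆ (x : Q) (y : Q) (_ : x * y ≤ a), LocPullback.tmul S.rMap S.dMap x y

theorem mem_mInv {a x y : Q} : (x, y) ∈ (S.mInv a).carrier ↔ x * y ≤ a := by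
  refine SupTensor.mem_rightAdjoint (μ := fun x y : Q => x * y)
    (fun T n => IsQuantale.sSup_mul_distrib T n) (fun m T => IsQuantale.mul_sSup_distrib m T) ?_
  intro m b n
  have := S.ract_mul b m n
  rwa [S.ract_eq, S.lact_eq] at this

theorem mInv_sSup (T : Set Q) : S.mInv (sSup T) = ⨆ a ∈ T, S.mInv a := by
  have := S.multiplicative T
  rw [S.ract_eq, S.lact_eq] at this
  exact this

/-- The multiplication of `𝒢(Q)`: `m^*` is the right adjoint of the multiplication
`Q ⊗_A Q → Q`. -/
def mMap : LocMap (LocPullback S.rMap S.dMap) Q :=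
  ⟨{ toFun := S.mInv
     map_inf' := fun a b => by
      apply SupTensor.ext
      ext ⟨x, y⟩
      erw [LocPullback.mem_inf, S.mem_mInv, S.mem_mInv, S.mem_mInv]
      exact le_inf_iff
     map_top' := top_le_iff.1 fun _ _ => S.mem_mInv.2 le_top
     map_sSup' := fun T => by rw [S.mInv_sSup, sSup_image] }⟩

theorem lift_mInv {Z : Type z} [Order.Frame Z] {h k : LocMap Z Q}
    (e : S.rMap.comp h = S.dMap.comp k) (a : Q) :
    (S.mMap.comp (LocPullback.lift h k e)).inv a =
      ⨆ (x : Q) (y : Q) (_ : x * y ≤ a), h.inv x ⊓ k.inv y := by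
  change (LocPullback.lift h k e).inv (S.mInv a) = _
  simp only [mInv, map_iSup, LocPullback.lift_tmul]

theorem supp_le_iff {x : Q} {a : A} : S.supp x ≤ a ↔ x ≤ S.lact a ⊤ := by
  constructor
  · intro h
    rw [← S.supp_lact_self x, ← inf_eq_left.2 h, S.lact_module.inf, ← S.lact_top_inf]
    refine le_trans ?_ (?_ : S.lact (S.supp x) (S.lact a x) ≤ _)
    · rw [S.lact_top_inf]
    · rw [← S.lact_top_inf, ← S.lact_top_inf a]
      exact inf_le_right.trans inf_le_left
  · intro h
    have := OrderHomClass.mono S.supp h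
    rw [S.supp_lact, S.supp_top, inf_top_eq] at this
    exact this

theorem supp_mul_le (x y : Q) : S.supp (x * y) ≤ S.supp x := by
  rw [← S.supp_lact_self x, S.lact_mul, S.supp_lact, S.supp_lact_self]
  exact inf_le_left

theorem le_mul_top (S : GroupoidQuantale A Q) (x : Q) : x ≤ x * ⊤ := by
  conv_lhs => rw [← S.supp_lact_self x]
  refine (S.supp_lact_le x x).trans ?_
  rw [mul_assoc]
  exact mul_le_mul_right le_top x

theorem supp_ract_le (x y : Q) : S.supp (S.ract x (S.supp y)) ≤ S.supp (x * y) := by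
  refine (OrderHomClass.mono S.supp (S.le_mul_top _)).trans ?_
  rw [S.ract_mul]
  refine (OrderHomClass.mono S.supp (mul_le_mul_right (S.supp_lact_le y ⊤) x)).trans ?_
  rw [mul_assoc y, ← mul_assoc x]
  exact S.supp_mul_le _ _

theorem d_mMap : S.dMap.comp S.mMap = S.dMap.comp (LocPullback.fst S.rMap S.dMap) := by
  apply LocMap.ext
  ext a
  change S.mInv (S.lact a ⊤) = LocPullback.tmul S.rMap S.dMap (S.lact a ⊤) ⊤
  apply le_antisymm
  · simp only [mInv, iSup_le_iff, LocPullback.tmul_le_iff]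
    intro x y h
    set U := LocPullback.tmul S.rMap S.dMap (S.lact a ⊤) ⊤
    have h1 : (S.ract x (S.supp y), y) ∈ U.carrier :=
      U.isBiideal.mono (S.supp_le_iff.1 ((S.supp_ract_le x y).trans (S.supp_le_iff.2 h)))
        le_top (LocPullback.mem_tmul _ _)
    rw [S.ract_eq] at h1
    have h2 := (U.isBiideal.balanced x (S.supp y) y).1 h1
    have h3 : S.dMap.inv (S.supp y) ⊓ y = y := (S.lact_top_inf _ _).trans (S.supp_lact_self y)
    change (x, S.dMap.inv (S.supp y) ⊓ y) ∈ U.carrier at h2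
    rwa [h3] at h2
  · rw [LocPullback.tmul_le_iff, mem_mInv, S.lact_mul, ← S.lact_top_inf a (⊤ * ⊤)]
    exact inf_le_left

theorem r_mMap : S.rMap.comp S.mMap = S.rMap.comp (LocPullback.snd S.rMap S.dMap) := by
  apply LocMap.ext
  ext a
  change S.mInv (S.ract ⊤ a) = LocPullback.tmul S.rMap S.dMap ⊤ (S.ract ⊤ a)
  apply le_antisymm
  · simp only [mInv, iSup_le_iff, LocPullback.tmul_le_iff]
    intro x y h
    set U := LocPullback.tmul S.rMap S.dMap ⊤ (S.ract ⊤ a)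
    have h0 : star y * star x ≤ S.lact a ⊤ := by
      have := S.star_mono h
      rwa [star_mul, S.star_ract, S.star_top] at this
    have h1 : S.lact (S.supp (star x)) y ≤ S.ract ⊤ a := by
      rw [← star_star y, ← S.star_ract, S.star_le_iff, S.star_ract, S.star_top,
        ← S.supp_le_iff]
      exact (S.supp_ract_le _ _).trans (S.supp_le_iff.2 h0)
    have h2 : (⊤, S.lact (S.supp (star x)) y) ∈ U.carrier :=
      U.isBiideal.mono le_rfl h1 (LocPullback.mem_tmul _ _)
    have h3 : (x, S.lact (S.supp (star x)) y) ∈ U.carrier :=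
      U.isBiideal.mono le_top le_rfl h2
    rw [S.lact_eq] at h3
    have h4 := (U.isBiideal.balanced x (S.supp (star x)) y).2 h3
    have h5 : x ⊓ S.rMap.inv (S.supp (star x)) = x := by
      refine (S.inf_ract_top _ _).trans ?_
      rw [← star_star x, ← S.star_lact, star_star, S.supp_lact_self]
    change (x ⊓ S.rMap.inv (S.supp (star x)), y) ∈ U.carrier at h4
    rwa [h5] at h4
  · rw [LocPullback.tmul_le_iff, mem_mInv, ← S.mul_ract, ← S.inf_ract_top a (⊤ * ⊤)]
    exact inf_le_right

theorem mInv_assoc (_ : GroupoidQuantale A Q) {Z : Type z} [Order.Frame Z] (h k l : Q → Z) (a : Q) :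
    ⨆ (x : Q) (y : Q) (_ : x * y ≤ a), h x ⊓ ⨆ (z : Q) (w : Q) (_ : z * w ≤ y), k z ⊓ l w =
      ⨆ (x : Q) (y : Q) (_ : x * y ≤ a),
        (⨆ (z : Q) (w : Q) (_ : z * w ≤ x), h z ⊓ k w) ⊓ l y := by
  refine eq_of_forall_ge_iff fun c => ?_
  simp only [inf_iSup_eq, iSup_inf_eq, iSup_le_iff]
  constructor
  · intro H x y hxy z w hzw
    have := H z (w * y) (by rw [← mul_assoc]; exact (mul_le_mul_left hzw y).trans hxy) w y le_rfl
    rwa [← inf_assoc] at this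
  · intro H x y hxy z w hzw
    have := H (x * z) w (by rw [mul_assoc]; exact (mul_le_mul_right hzw x).trans hxy) x z le_rfl
    rwa [inf_assoc] at this

theorem star_υ (a : Q) : S.υ (star a) = S.υ a := by
  have key : ∀ a, S.υ a ≤ S.υ (star a) := by
    intro a
    have h1 : S.lact (S.υ a) ⊤ ≤ ⨆ (x : Q) (_ : x * star x ≤ star a), x := by
      rw [S.inverse_law]
      refine iSup₂_le fun x hx => le_iSup₂_of_le x ?_ le_rfl
      have := S.star_mono hx
      rwa [star_mul, star_star] at this
    rw [← S.inverse_law] at h1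
    have := OrderHomClass.mono S.υ h1
    rwa [S.υ_lact, S.υ_lact] at this
  exact le_antisymm (by simpa using key (star a)) (key a)

theorem inverse_law' (a : Q) :
    ⨆ (x : Q) (y : Q) (_ : x * y ≤ a), x ⊓ star y = S.lact (S.υ a) ⊤ := by
  rw [S.inverse_law]
  apply le_antisymm
  · refine iSup_le fun x => iSup_le fun y => iSup_le fun h => ?_
    refine le_iSup₂_of_le (x ⊓ star y) ?_ le_rfl
    refine (mul_le_mul' inf_le_left ?_).trans h
    rw [S.star_le_iff]
    exact inf_le_right
  · refine iSup₂_le fun x h => ?_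
    refine le_iSup_of_le x (le_iSup_of_le (star x) (le_iSup_of_le h ?_))
    rw [star_star, inf_idem]

theorem unit_law' (a : Q) : ⨆ (x : Q) (y : Q) (_ : x * y ≤ a), S.ract x (S.υ y) = a := by
  have h := congrArg star (S.unit_law (star a))
  rw [star_star] at h
  have hs : ∀ (f : Q → Q), star (⨆ x, f x) = ⨆ x, star (f x) := fun f => by
    rw [← sSup_range, S.star_sSup, iSup_range]
  refine Eq.trans ?_ h
  refine eq_of_forall_ge_iff fun c => ?_
  have hR : star (⨆ (x : Q) (y : Q) (_ : x * y ≤ star a), S.lact (S.υ x) y) ≤ c ↔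
      ∀ x y, x * y ≤ star a → S.lact (S.υ x) y ≤ star c := by
    rw [S.star_le_iff]
    simp only [iSup_le_iff]
  rw [hR]
  simp only [iSup_le_iff]
  constructor
  · intro H x y hxy
    have := S.star_mono (H (star y) (star x)
      (by rw [← star_mul, S.star_le_iff]; exact hxy))
    rwa [S.star_ract, S.star_υ, star_star] at this
  · intro H x y hxy
    have := S.star_mono (H (star y) (star x) (by rw [← star_mul]; exact S.star_mono hxy))
    rwa [S.star_lact, S.star_υ, star_star, star_star] at this

theorem d_uMap : S.dMap.comp S.uMap = LocMap.id A :=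
  LocMap.ext (FrameHom.ext S.υ_lact)

theorem r_uMap : S.rMap.comp S.uMap = LocMap.id A :=
  LocMap.ext (FrameHom.ext S.υ_ract)

theorem d_iMap : S.dMap.comp S.iMap = S.rMap := by
  apply LocMap.ext
  ext a
  change star (S.lact a ⊤) = S.ract ⊤ a
  rw [S.star_lact, S.star_top]

theorem r_iMap : S.rMap.comp S.iMap = S.dMap := by
  apply LocMap.ext
  ext a
  change star (S.ract ⊤ a) = S.lact a ⊤
  rw [S.star_ract, S.star_top]

/-- The open groupoid `𝒢(Q)` of a groupoid quantale `Q` with base locale `A`: its locale of objects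
is `A`, its locale of arrows is `Q`, and its structure maps are given by `d^* a = a ⊤`,
`r^* a = ⊤ a`, `u^* = υ`, `i^* = star` and `m^* a = ⋁ {x ⊗ y | x y ≤ a}`. -/
def groupoid : OpenGroupoid A Q where
  d := S.dMap
  r := S.rMap
  u := S.uMap
  i := S.iMap
  m := S.mMap
  d_u := S.d_uMap
  r_u := S.r_uMap
  d_m := S.d_mMap
  r_m := S.r_mMap
  d_i := S.d_iMap
  r_i := S.r_iMap
  assoc := by
    intro π₁ π₂
    apply LocMap.ext
    ext a
    rw [S.lift_mInv, S.lift_mInv]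
    refine Eq.trans ?_ ((S.mInv_assoc π₁.inv
      (((LocPullback.fst S.rMap S.dMap).comp π₂).inv)
      (((LocPullback.snd S.rMap S.dMap).comp π₂).inv) a).trans ?_)
    · congr! 7 with x y h
      change π₂.inv (S.mInv _) = _
      simp only [mInv, map_iSup, ← LocPullback.fst_inf_snd, map_inf]
      rfl
    · congr! 7 with x y h
      exact (S.lift_mInv _ _).symm
  unit_left := by
    apply LocMap.ext
    ext a
    rw [S.lift_mInv]
    refine Eq.trans ?_ (S.unit_law a)
    refine iSup_congr fun x => iSup_congr fun y => iSup_congr fun _ => ?_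
    exact S.lact_top_inf _ _
  unit_right := by
    apply LocMap.ext
    ext a
    rw [S.lift_mInv]
    refine Eq.trans ?_ (S.unit_law' a)
    refine iSup_congr fun x => iSup_congr fun y => iSup_congr fun _ => ?_
    exact S.inf_ract_top _ _
  inv_right := by
    apply LocMap.ext
    ext a
    rw [S.lift_mInv]
    exact S.inverse_law' a
  inv_left := by
    apply LocMap.ext
    ext a
    rw [S.lift_mInv]
    have h := congrArg star (S.inverse_law' a)
    rw [S.star_lact, S.star_top] at h
    refine Eq.trans ?_ h
    change _ = S.iMap.inv _
    simp only [map_iSup, map_inf]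
    refine iSup_congr fun x => iSup_congr fun y => iSup_congr fun _ => ?_
    exact congrArg (fun t => star x ⊓ t) (star_star y).symm
  d_open := ⟨S.supp,
    { gc := fun _ _ => S.supp_le_iff
      frobenius := fun x a => by
        change S.supp (x ⊓ S.lact a ⊤) = _
        rw [inf_comm x, S.lact_top_inf, S.supp_lact, inf_comm] }⟩

end GroupoidQuantale

/-! ## Modules over a groupoid quantale -/

section Modules

variable {A : Type u} {Q : Type v} [Order.Frame A] [Order.Frame Q]
  [Semigroup Q] [IsQuantale Q] [StarMul Q]

/-- A left `Q`-module: a locale `X` with a left action `act` of `Q` and a unital left `A`-module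
structure `base`. -/
structure QModule (S : GroupoidQuantale A Q) (X : Type w) [Order.Frame X] where
  act : Q → X → X
  base : A → X → X
  act_sSup_left : ∀ (T : Set Q) (x : X), act (sSup T) x = ⨆ q ∈ T, act q x
  act_sSup_right : ∀ (q : Q) (T : Set X), act q (sSup T) = ⨆ x ∈ T, act q x
  mul_act : ∀ q q' x, act (q * q') x = act q (act q' x)
  base_module : IsFrameModule base
  lact_act : ∀ a q x, act (S.lact a q) x = base a (act q x)
  ract_act : ∀ a q x, act (S.ract q a) x = act q (base a x)
  base_inf : ∀ a x y, base a (x ⊓ y) = base a x ⊓ y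

/-- A pre-Hilbert `Q`-module. -/
structure PreHilbertQModule (S : GroupoidQuantale A Q) (X : Type w) [Order.Frame X] extends
    QModule S X where
  inner : X → X → Q
  inner_act : ∀ q x y, inner (act q x) y = q * inner x y
  inner_base : ∀ a x, S.lact a (inner x ⊤) = inner (base a x) ⊤
  inner_sSup : ∀ (T : Set X) (y : X), inner (sSup T) y = ⨆ x ∈ T, inner x y
  inner_star : ∀ x y, inner x y = star (inner y x)

/-- A stably supported `Q`-module. -/
structure StablySupportedQModule (S : GroupoidQuantale A Q) (X : Type w) [Order.Frame X] extends
    PreHilbertQModule S X where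
  supp : X → A
  supp_mono : Monotone supp
  supp_top : supp ⊤ = ⊤
  supp_base_le : ∀ x, base (supp x) ⊤ ≤ act (inner x x) ⊤
  supp_base_self : ∀ x, base (supp x) x = x
  /-- stability of the support -/
  supp_act_le : ∀ q x, supp (act q x) ≤ S.supp q

/-- A `Q`-locale. -/
structure QLocale (S : GroupoidQuantale A Q) (X : Type w) [Order.Frame X] extends
    StablySupportedQModule S X where
  /-- multiplicativity: the right adjoint of `Q ⊗_A X → X` preserves joins -/
  multiplicative : ∀ T : Set X,
    SupTensor.rightAdjoint S.ract base act (sSup T) =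
      ⨆ x ∈ T, SupTensor.rightAdjoint S.ract base act x
  unit_law : ∀ x, ⨆ (q : Q) (y : X) (_ : act q y ≤ x), base (S.υ q) y = x

/-- A principal `Q`-locale over `M`. The structure of an open `M`-locale on `X` is a map of locales
`π : X → M` with direct image `tsupp`. The tensor product `X ⊗_M X` is taken with respect to the
action of `M` on `X` along `π^*`. -/
structure PrincipalQLocale (S : GroupoidQuantale A Q) (X : Type w) (M : Type z) [Order.Frame X]
    [Order.Frame M] extends QLocale S X where
  π : LocMap X M
  tsupp : X → M
  π_open : π.IsOpenDirectImage tsupp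
  tsupp_top : tsupp ⊤ = ⊤
  tsupp_act : ∀ q x, tsupp (act q x) = tsupp (base (S.supp (star q)) x)
  /-- the assignment `x ⊗ y ↦ ⋁ {q ⊗ (z ∧ y) | q z ≤ x}` defines a frame isomorphism
  `X ⊗_M X → Q ⊗_A X` -/
  pairing_iso :
    ∃ φ : SupTensor (fun (x : X) (b : M) => x ⊓ π.inv b) (fun (b : M) (y : X) => π.inv b ⊓ y) ≃o
        SupTensor S.ract base,
      ∀ x y, φ (SupTensor.tmul _ _ x y) =
        ⨆ (q : Q) (z : X) (_ : act q z ≤ x), SupTensor.tmul S.ract base q (z ⊓ y)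

end Modules

/-! Since `a|x = a|⊤ ⊓ x`, the base action is meet with `p^* a`, so `Q ⊗_A X` is the frame of `G₁
×_{G₀} X`. The map `𝔞^*` is the right adjoint of the module action `Q ⊗_A X → X`: it preserves meets
as a right adjoint and joins by multiplicativity. Associativity and the unit axiom are then those of
the module, read through the adjunction.

The anchor is controlled by `⟨⊤,⊤⟩`. From `ς_X(⊤) = ⊤` one gets `⟨⊤,⊤⟩·⊤ = ⊤`, and stability gives
`ς_Q⟨⊤,⊤⟩ = ⊤`. Hence `a = ς_Q(a|⟨⊤,⊤⟩) = ς_Q⟨a|⊤,⊤⟩` is recovered from `a|⊤`, so `p^*` reflects the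
order (`base_top_le_iff`). With stability this makes `ς_X` left adjoint to `p^*`, and `supp_base` is
the Frobenius condition.

The two equations `p ∘ 𝔞 = d ∘ π₁` and `π ∘ 𝔞 = π ∘ π₂` come from moving a support across the tensor
sign: `q ⊗ x = q|ς_X(x) ⊗ x` and `q ⊗ x = q ⊗ ς_Q(q^*)|x`. The first needs the estimate
`supp_ract_le_supp_inner`, the second the axiom `tsupp_act`. Finally the pairing has inverse image
`x ⊗ y ↦ 𝔞^* x ⊓ π₂^* y`, which is the given isomorphism on generators. -/

namespace QModule

variable {A : Type u} {Q : Type v} {X : Type w} [Order.Frame A] [Order.Frame Q] [Order.Frame X]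
  [Semigroup Q] [IsQuantale Q] [StarMul Q] {S : GroupoidQuantale A Q} (L : QModule S X)

/-! ### The base action as meet, and the adjoint of the module action. -/

theorem base_top_inf (a : A) (x : X) : L.base a ⊤ ⊓ x = L.base a x := by
  rw [← L.base_inf, top_inf_eq]

theorem base_le (a : A) (x : X) : L.base a x ≤ x :=
  (L.base_top_inf a x).symm.trans_le inf_le_right

theorem base_mono (a : A) {x y : X} (h : x ≤ y) : L.base a x ≤ L.base a y := by
  rw [← L.base_top_inf, ← L.base_top_inf a y]
  exact inf_le_inf_left _ h

theorem act_mono {q q' : Q} {x x' : X} (hq : q ≤ q') (hx : x ≤ x') :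
    L.act q x ≤ L.act q' x' := by
  have h1 : L.act q x ≤ L.act q' x := by
    have := L.act_sSup_left {q, q'} x
    rw [sSup_pair, sup_eq_right.2 hq] at this
    rw [this]
    exact le_iSup₂ (f := fun r (_ : r ∈ ({q, q'} : Set Q)) => L.act r x) q (by simp)
  have h2 : L.act q' x ≤ L.act q' x' := by
    have := L.act_sSup_right q' {x, x'}
    rw [sSup_pair, sup_eq_right.2 hx] at this
    rw [this]
    exact le_iSup₂ (f := fun y (_ : y ∈ ({x, x'} : Set X)) => L.act q' y) x (by simp)
  exact h1.trans h2

/-- The anchor map, with inverse image `a ↦ a|⊤`. -/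
def anchor : LocMap X A :=
  ⟨{ toFun := fun a => L.base a ⊤
     map_inf' := fun a b => by rw [L.base_module.inf, L.base_top_inf]
     map_top' := L.base_module.top _
     map_sSup' := fun T => by rw [L.base_module.sSup_left, sSup_image] }⟩

theorem anchor_inv (a : A) : L.anchor.inv a = L.base a ⊤ := rfl

/-- Rewriting with this and `S.ract_eq` turns `Q ⊗_A X`, as it occurs in the axioms, into the frame
of the pullback. -/
theorem base_eq : L.base = fun a x => L.anchor.inv a ⊓ x := by
  funext a x
  exact (L.base_top_inf a x).symm

/-- The map `x ↦ ⋁ {q ⊗ y | q · y ≤ x}` to the frame of `G₁ ×_{G₀} X`. -/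
def actInv (x : X) : LocPullback S.rMap L.anchor :=
  ⨆ (q : Q) (y : X) (_ : L.act q y ≤ x), LocPullback.tmul S.rMap L.anchor q y

/-- This is the adjunction in concrete form: the action is bilinear and balanced, so the pairs with
`q · y ≤ x` already form a bi-ideal and the join of tensors adds nothing. -/
theorem mem_actInv {x : X} {q : Q} {y : X} : (q, y) ∈ (L.actInv x).carrier ↔ L.act q y ≤ x := by
  refine SupTensor.mem_rightAdjoint (μ := L.act) L.act_sSup_left L.act_sSup_right ?_
  intro q a y
  have := L.ract_act a q y
  rwa [S.ract_eq, L.base_eq] at this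

/-- Each side is the join of `h r ⊓ k s ⊓ l w` over all triples with `r · (s · w) ≤ x`, equivalently
`(r s) · w ≤ x`. The functions are arbitrary, so that the components of any map of locales can be
substituted. -/
theorem actInv_assoc {Z : Type z} [Order.Frame Z] (h k : Q → Z) (l : X → Z) (x : X) :
    ⨆ (q : Q) (y : X) (_ : L.act q y ≤ x),
        h q ⊓ ⨆ (r : Q) (w : X) (_ : L.act r w ≤ y), k r ⊓ l w =
      ⨆ (q : Q) (y : X) (_ : L.act q y ≤ x),
        (⨆ (r : Q) (s : Q) (_ : r * s ≤ q), h r ⊓ k s) ⊓ l y := by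
  refine eq_of_forall_ge_iff fun c => ?_
  simp only [inf_iSup_eq, iSup_inf_eq, iSup_le_iff]
  constructor
  · intro H q y hqy r s hrs
    -- The largest constraint is met by the product itself: `s · y` serves as the intermediate
    -- element here, and `q * r` in the converse.
    have := H r (L.act s y)
      (by rw [← L.mul_act]; exact (L.act_mono hrs le_rfl).trans hqy) s y le_rfl
    rwa [← inf_assoc] at this
  · intro H q y hqy r w hrw
    have := H (q * r) w
      (by rw [L.mul_act]; exact (L.act_mono le_rfl hrw).trans hqy) q r le_rfl
    rwa [inf_assoc] at this

end QModule

/-! ### Supports, and openness and surjectivity of the anchor map. -/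

namespace QLocale

variable {A : Type u} {Q : Type v} {X : Type w} [Order.Frame A] [Order.Frame Q] [Order.Frame X]
  [Semigroup Q] [IsQuantale Q] [StarMul Q] {S : GroupoidQuantale A Q} (L : QLocale S X)

theorem inner_mono_left {x x' : X} (h : x ≤ x') (y : X) : L.inner x y ≤ L.inner x' y := by
  have := L.inner_sSup {x, x'} y
  rw [sSup_pair, sup_eq_right.2 h] at this
  rw [this]
  exact le_iSup₂ (f := fun w (_ : w ∈ ({x, x'} : Set X)) => L.inner w y) x (by simp)

theorem inner_le_inner_top (x y : X) : L.inner x y ≤ L.inner x ⊤ := by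
  rw [L.inner_star x y, L.inner_star x ⊤]
  exact S.star_mono (L.inner_mono_left le_top x)

theorem act_inner_top_top : L.act (L.inner ⊤ ⊤) ⊤ = ⊤ := by
  refine top_le_iff.1 (le_trans (le_of_eq ?_) (L.supp_base_le ⊤))
  rw [L.supp_top, L.base_module.top]

theorem supp_inner_top_top : S.supp (L.inner ⊤ ⊤) = ⊤ := by
  have := L.supp_act_le (L.inner ⊤ ⊤) ⊤
  rwa [L.act_inner_top_top, L.supp_top, top_le_iff] at this

theorem supp_lact_inner (a : A) : S.supp (S.lact a (L.inner ⊤ ⊤)) = a := by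
  rw [S.supp_lact, L.supp_inner_top_top, inf_top_eq]

/-- Pairing with `⊤` carries `a|⊤` to `a|⟨⊤,⊤⟩`, whose support in `Q` is `a`. This yields the
injectivity of `p^*`, and lets inequalities in `A` be tested in `X`. -/
theorem base_top_le_iff {a b : A} : L.base a ⊤ ≤ L.base b ⊤ ↔ a ≤ b := by
  refine ⟨fun h => ?_, fun h => OrderHomClass.mono L.anchor.inv h⟩
  have := OrderHomClass.mono S.supp (L.inner_mono_left h ⊤)
  rwa [← L.inner_base, ← L.inner_base, L.supp_lact_inner, L.supp_lact_inner] at this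

/-- Writing `a|⊤` as `(a|⟨⊤,⊤⟩) · ⊤` makes stability of the support applicable. -/
theorem supp_base_top_le (a : A) : L.supp (L.base a ⊤) ≤ a := by
  conv_lhs => rw [← L.act_inner_top_top, ← L.lact_act]
  exact (L.supp_act_le _ _).trans (L.supp_lact_inner a).le

theorem supp_le_iff {x : X} {a : A} : L.supp x ≤ a ↔ x ≤ L.base a ⊤ := by
  constructor
  · intro h
    conv_lhs => rw [← L.supp_base_self x]
    exact (L.base_mono _ le_top).trans (L.base_top_le_iff.2 h)
  · exact fun h => (L.supp_mono h).trans (L.supp_base_top_le a)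

theorem supp_base (a : A) (x : X) : L.supp (L.base a x) = L.supp x ⊓ a := by
  apply le_antisymm
  · exact le_inf (L.supp_mono (L.base_le a x))
      ((L.supp_mono (L.base_mono a le_top)).trans (L.supp_base_top_le a))
  · rw [← L.base_top_le_iff, inf_comm, L.base_module.inf]
    refine (L.base_mono a (L.supp_base_le x)).trans ?_
    -- `inner_base` applies only when the second argument is `⊤`, so `⟨x,x⟩` is enlarged to `⟨x,⊤⟩`
    -- before `a` is moved inside.
    refine (L.base_mono a (L.act_mono (L.inner_le_inner_top x x) le_rfl)).trans ?_
    rw [← L.lact_act, L.inner_base]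
    -- The support of `a|x` is inserted inside the inner product and pulled back out to the front,
    -- where it bounds the whole element.
    conv_lhs => rw [← L.supp_base_self (L.base a x)]
    rw [← L.inner_base, L.lact_act]
    exact L.base_mono _ le_top

theorem anchor_isOpenDirectImage : L.anchor.IsOpenDirectImage L.supp where
  gc := fun _ _ => L.supp_le_iff
  frobenius := fun x a => by
    rw [L.anchor_inv, inf_comm, L.base_top_inf, L.supp_base]

theorem anchor_isSurjection : L.anchor.IsSurjection := fun _ _ h =>
  le_antisymm (L.base_top_le_iff.1 h.le) (L.base_top_le_iff.1 h.ge)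

/-- Inner products move the question into `Q`, whose support is equivariant. Multiplying by `⟨⊤,⊤⟩`
loses no support, and `ς_X(x)|⊤ ≤ ⟨x,x⟩·⊤` then leads to `q⟨x,x⟩⟨⊤,⊤⟩`, where the last factor can be
dropped and `q⟨x,x⟩ = ⟨q·x,x⟩`. -/
theorem supp_ract_le_supp_inner (q : Q) (x : X) :
    S.supp (S.ract q (L.supp x)) ≤ S.supp (L.inner (L.act q x) ⊤) := by
  have h1 : S.supp (S.ract q (L.supp x)) ≤
      S.supp (S.ract q (L.supp x) * L.inner ⊤ ⊤) := by
    have := S.supp_ract_le (S.ract q (L.supp x)) (L.inner ⊤ ⊤)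
    rwa [L.supp_inner_top_top, S.ract_module.top] at this
  refine h1.trans ?_
  rw [S.ract_mul, L.inner_base]
  refine (OrderHomClass.mono S.supp
    (mul_le_mul_right (L.inner_mono_left (L.supp_base_le x) ⊤) q)).trans ?_
  rw [L.inner_act, ← mul_assoc]
  refine (S.supp_mul_le _ _).trans (OrderHomClass.mono S.supp ?_)
  rw [L.inner_act]
  exact mul_le_mul_right (L.inner_le_inner_top x x) q

/-! ### The action map and the associated `𝒢(Q)`-locale. -/

theorem actInv_sSup (T : Set X) : L.actInv (sSup T) = ⨆ x ∈ T, L.actInv x := by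
  have := L.multiplicative T
  rw [S.ract_eq, L.base_eq] at this
  exact this

/-- The action map, whose inverse image is the right adjoint of `Q ⊗_A X → X`. -/
def actMap : LocMap (LocPullback S.rMap L.anchor) X :=
  ⟨{ toFun := L.actInv
     map_inf' := fun x y => by
      -- Compared as bi-ideals, the two sides say that `q · w` lies below a meet exactly when it
      -- lies below both factors.
      apply SupTensor.ext
      ext ⟨q, w⟩
      erw [LocPullback.mem_inf, L.mem_actInv, L.mem_actInv, L.mem_actInv]
      exact le_inf_iff
     map_top' := top_le_iff.1 fun _ _ => L.mem_actInv.2 le_top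
     map_sSup' := fun T => by rw [L.actInv_sSup, sSup_image] }⟩

theorem actMap_inv (x : X) : L.actMap.inv x =
    ⨆ (q : Q) (y : X) (_ : L.act q y ≤ x), LocPullback.tmul S.rMap L.anchor q y := rfl

/-- Needed for associativity, where the inner action is composed with a projection into the pullback
that is not presented as a pairing. -/
theorem map_actInv {Z : Type z} [Order.Frame Z] (k : LocMap Z (LocPullback S.rMap L.anchor))
    (x : X) : k.inv (L.actInv x) =
      ⨆ (q : Q) (y : X) (_ : L.act q y ≤ x),
        ((LocPullback.fst S.rMap L.anchor).comp k).inv q ⊓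
          ((LocPullback.snd S.rMap L.anchor).comp k).inv y := by
  simp only [QModule.actInv, map_iSup, ← LocPullback.fst_inf_snd, map_inf]
  rfl

theorem lift_actMap {Z : Type z} [Order.Frame Z] {h : LocMap Z Q} {k : LocMap Z X}
    (e : S.rMap.comp h = L.anchor.comp k) (x : X) :
    (L.actMap.comp (LocPullback.lift h k e)).inv x =
      ⨆ (q : Q) (y : X) (_ : L.act q y ≤ x), h.inv q ⊓ k.inv y := by
  change (LocPullback.lift h k e).inv (L.actMap.inv x) = _
  simp only [actMap_inv, map_iSup, LocPullback.lift_tmul]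

theorem anchor_actMap :
    L.anchor.comp L.actMap = S.dMap.comp (LocPullback.fst S.rMap L.anchor) := by
  apply LocMap.ext
  ext a
  change L.actInv (L.base a ⊤) = LocPullback.tmul S.rMap L.anchor (S.lact a ⊤) ⊤
  apply le_antisymm
  · simp only [QModule.actInv, iSup_le_iff, LocPullback.tmul_le_iff]
    intro q x h
    set U := LocPullback.tmul S.rMap L.anchor (S.lact a ⊤) ⊤
    -- From `q · x ≤ a|⊤` the estimate gives `ς_Q(q|ς_X(x)) ≤ ς_Q⟨a|⊤,⊤⟩ ≤ a`.
    have h0 : S.ract q (L.supp x) ≤ S.lact a ⊤ := by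
      refine S.supp_le_iff.1 ((L.supp_ract_le_supp_inner q x).trans (S.supp_le_iff.2 ?_))
      refine (L.inner_mono_left h ⊤).trans ?_
      rw [← L.inner_base, ← S.lact_top_inf]
      exact inf_le_left
    have h1 : (S.ract q (L.supp x), x) ∈ U.carrier :=
      U.isBiideal.mono h0 le_top (LocPullback.mem_tmul _ _)
    rw [S.ract_eq] at h1
    -- Balancing moves `ς_X(x)` to the right factor, where it is absorbed by `x`.
    have h2 := (U.isBiideal.balanced q (L.supp x) x).1 h1
    have h3 : L.anchor.inv (L.supp x) ⊓ x = x :=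
      (L.base_top_inf _ _).trans (L.supp_base_self x)
    change (q, L.anchor.inv (L.supp x) ⊓ x) ∈ U.carrier at h2
    rwa [h3] at h2
  · rw [LocPullback.tmul_le_iff, L.mem_actInv, L.lact_act]
    exact L.base_mono a le_top

/-- The `𝒢(Q)`-locale of a `Q`-locale. -/
def gLocale : GLocale S.groupoid X where
  p := L.anchor
  act := L.actMap
  p_act := L.anchor_actMap
  assoc := by
    intro π₁ π₂
    apply LocMap.ext
    ext x
    erw [L.lift_actMap, L.lift_actMap]
    refine Eq.trans ?_ ((L.actInv_assoc π₁.inv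
      (((LocPullback.fst S.rMap L.anchor).comp π₂).inv)
      (((LocPullback.snd S.rMap L.anchor).comp π₂).inv) x).trans ?_)
    · congr! 7 with q y h
      exact L.map_actInv π₂ y
    · congr! 7 with q y h
      exact (S.lift_mInv _ _).symm
  unit := by
    apply LocMap.ext
    ext x
    erw [L.lift_actMap]
    refine Eq.trans ?_ (L.unit_law x)
    refine iSup_congr fun q => iSup_congr fun y => iSup_congr fun _ => ?_
    exact L.base_top_inf _ _

end QLocale

/-! ### Isomorphisms of locales from order isomorphisms of frames. -/

namespace LocMap

variable {X : Type u} {Y : Type v} [Order.Frame X] [Order.Frame Y]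

theorem isIso_of_orderIso {f : LocMap X Y} (φ : Y ≃o X) (h : ∀ y, f.inv y = φ y) : f.IsIso := by
  refine ⟨⟨{ toFun := φ.symm
             map_inf' := φ.symm.map_inf
             map_top' := φ.symm.map_top
             map_sSup' := fun T => by rw [φ.symm.map_sSup, sSup_image] }⟩, ?_, ?_⟩
  · apply LocMap.ext
    ext x
    exact (h _).trans (φ.apply_symm_apply x)
  · apply LocMap.ext
    ext y
    exact (congrArg φ.symm (h y)).trans (φ.symm_apply_apply y)

end LocMap

/-! ### The projection and the pairing map. -/

namespace PrincipalQLocale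

variable {A : Type u} {Q : Type v} {X : Type w} {M : Type z} [Order.Frame A] [Order.Frame Q]
  [Order.Frame X] [Order.Frame M] [Semigroup Q] [IsQuantale Q] [StarMul Q]
  {S : GroupoidQuantale A Q} (L : PrincipalQLocale S X M)

theorem π_isSurjection : L.π.IsSurjection := by
  have key : ∀ b, L.tsupp (L.π.inv b) = b := fun b => by
    have := L.π_open.frobenius ⊤ b
    rwa [top_inf_eq, L.tsupp_top, top_inf_eq] at this
  exact fun a b h => by rw [← key a, h, key b]

/-- By adjunction only the direct images matter, and `tsupp_act` says that those of `q · x` and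
`ς_Q(q^*)|x` coincide. -/
theorem act_le_π_iff {q : Q} {x : X} {b : M} :
    L.act q x ≤ L.π.inv b ↔ L.base (S.supp (star q)) x ≤ L.π.inv b := by
  rw [← L.π_open.gc, ← L.π_open.gc, L.tsupp_act]

theorem π_actMap :
    L.π.comp L.actMap = L.π.comp (LocPullback.snd S.rMap L.anchor) := by
  apply LocMap.ext
  ext b
  change L.actInv (L.π.inv b) = LocPullback.tmul S.rMap L.anchor ⊤ (L.π.inv b)
  apply le_antisymm
  · simp only [QModule.actInv, iSup_le_iff, LocPullback.tmul_le_iff]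
    intro q x h
    set U := LocPullback.tmul S.rMap L.anchor ⊤ (L.π.inv b)
    have h1 : (q, L.base (S.supp (star q)) x) ∈ U.carrier :=
      U.isBiideal.mono le_top (L.act_le_π_iff.1 h) (LocPullback.mem_tmul _ _)
    rw [L.base_eq] at h1
    have h2 := (U.isBiideal.balanced q (S.supp (star q)) x).2 h1
    -- The involution turns `ς_Q(q^*)|q^* = q^*` into `q|ς_Q(q^*) = q`, so `q` absorbs the support
    -- that balancing has moved to its side.
    have h3 : q ⊓ S.rMap.inv (S.supp (star q)) = q := by
      refine (S.inf_ract_top _ _).trans ?_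
      rw [← star_star q, ← S.star_lact, star_star, S.supp_lact_self]
    change (q ⊓ S.rMap.inv (S.supp (star q)), x) ∈ U.carrier at h2
    rwa [h3] at h2
  · rw [LocPullback.tmul_le_iff, L.mem_actInv, L.act_le_π_iff]
    exact L.base_le _ _

/-- The `𝒢(Q)`-bundle of a principal `Q`-locale. -/
def gBundle : GBundle S.groupoid X M where
  toGLocale := L.gLocale
  π := L.π
  invariant := L.π_actMap

/-- The pairing map `⟨act, π₂⟩`. -/
def pairingMap : LocMap (LocPullback S.rMap L.anchor) (LocPullback L.π L.π) :=
  LocPullback.lift L.actMap (LocPullback.snd S.rMap L.anchor) L.π_actMap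

theorem pairingMap_tmul (x y : X) :
    L.pairingMap.inv (LocPullback.tmul L.π L.π x y) =
      ⨆ (q : Q) (w : X) (_ : L.act q w ≤ x), LocPullback.tmul S.rMap L.anchor q (w ⊓ y) := by
  refine (LocPullback.lift_tmul L.π_actMap x y).trans ?_
  rw [L.actMap_inv, LocPullback.snd_inv]
  simp only [iSup_inf_eq, LocPullback.tmul_inf_tmul, inf_top_eq]

theorem pairingMap_isIso : L.pairingMap.IsIso := by
  have h := L.pairing_iso
  rw [S.ract_eq, L.base_eq] at h
  obtain ⟨φ, hφ⟩ := h
  let ψ : LocPullback L.π L.π ≃o LocPullback S.rMap L.anchor := φ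
  have hψ : ∀ x y, ψ (LocPullback.tmul L.π L.π x y) =
      L.pairingMap.inv (LocPullback.tmul L.π L.π x y) := fun x y =>
    (hφ x y).trans (L.pairingMap_tmul x y).symm
  -- Both maps preserve joins and every open is a join of tensors `x ⊗ y`, so agreement on these
  -- suffices.
  refine LocMap.isIso_of_orderIso ψ fun U => ?_
  rw [LocPullback.eq_sSup_tmul U]
  simp only [map_iSup, hψ]

end PrincipalQLocale

theorem mainTheorem3 {A : Type u} {Q : Type v} {X : Type w} {M : Type z}
    [Order.Frame A] [Order.Frame Q] [Order.Frame X] [Order.Frame M]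
    [Semigroup Q] [IsQuantale Q] [StarMul Q]
    (S : GroupoidQuantale A Q) (L : PrincipalQLocale S X M) :
    ∃ E : GBundle S.groupoid X M,
      (∀ a : A, E.p.inv a = L.base a ⊤) ∧
      (∀ x : X, E.act.inv x =
        ⨆ (q : Q) (y : X) (_ : L.act q y ≤ x), LocPullback.tmul S.groupoid.r E.p q y) ∧
      E.π = L.π ∧
      E.IsFullyOpen ∧
      E.IsPrincipal := by
  -- The structure maps of `S.groupoid` and of `L.gBundle` unfold to those used above; in particular
  -- `L.gBundle.pairing` is `L.pairingMap` by definition.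
  exact ⟨L.gBundle, L.anchor_inv, L.actMap_inv, rfl,
    ⟨⟨L.supp, L.anchor_isOpenDirectImage⟩, L.anchor_isSurjection⟩,
    { π_open := ⟨L.tsupp, L.π_open⟩
      π_surjection := L.π_isSurjection
      pairing_isIso := L.pairingMap_isIso }⟩
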